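/- Let $\mathbb{K}$ be a field, $S=\mathbb{K}[x_1,\dots,x_n]$ with its standard $\mathbb{Z}^n$-grading, and let $M$ be a finitely generated $\mathbb{Z}^n$-graded $S$-module. For a homogeneous $u\in M$ and $Z\subseteq\{x_1,\dots,x_n\}$, the $\mathbb{K}$-subspace $u\mathbb{K}[Z]$ of $M$ spanned by all $uv$ with $v$ a monomial in $\mathbb{K}[Z]$ is called a Stanley space of dimension $|Z|$ if it is a free $\mathbb{K}[Z]$-module with basis $u$. A Stanley decomposition of $M$ is a decomposition of $M$ into a finite direct sum of Stanley spaces; its Stanley depth is the minimum of the dimensions of its summands, and ${\rm sdepth}(M)$ is the maximum of the Stanley depths of all Stanley decompositions of $M$, with ${\rm sdepth}(0)=\infty$. For an ideal $J\subseteq S$, the integral closure $\overline{J}$ is the ideal of all $f\in S$ satisfying an equation $f^m+c_1f^{m-1}+\dots+c_m=0$ with $m\ge 1$ and $c_i\in J^i$ for all $i$. If $J$ is a monomial ideal, so is $\overline{J}$. Theorem. Let $I\subset S$ be a monomial ideal which is a complete intersection, i.e. is generated by a regular sequence (in particular $I\neq S$; $I=0$ is allowed), and which is minimally generated by $t$ monomials.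 Then $t\le n$, and for every integer $k\ge 1$: (i) ${\rm sdepth}(\overline{I^k})\ge n-t+1$; (ii) ${\rm sdepth}(S/\overline{I^k})=n-t$. -/

import Mathlib

/-! ### Integral closure of an ideal -/

/-- `f` is integral over the ideal `I`: it satisfies an equation
`f ^ k + c₁ * f ^ (k - 1) + ⋯ + cₖ = 0` with `cᵢ ∈ I ^ i`; here the left-hand side is written as
the value at `f` of a monic polynomial `p` of degree `k`. -/
def IsIntegralOverIdeal {R : Type*} [CommRing R] (I : Ideal R) (f : R) : Prop :=
  ∃ p : Polynomial R, p.Monic ∧ p.eval f = 0 ∧ ∀ i, p.coeff i ∈ I ^ (p.natDegree - i)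

open Polynomial in
/-- Integrality over `I` in terms of the Rees algebra; used only to see that the elements
integral over `I` form an ideal. -/
theorem isIntegralOverIdeal_iff {R : Type*} [CommRing R] (I : Ideal R) (f : R) :
    IsIntegralOverIdeal I f ↔ IsIntegral (reesAlgebra I) (C f * X : R[X]) := by
  constructor
  · rintro ⟨p, hp, he, hc⟩
    let a : ℕ → reesAlgebra I := fun i =>
      ⟨monomial (p.natDegree - i) (p.coeff i), reesAlgebra.monomial_mem.2 (hc i)⟩
    refine ⟨X ^ p.natDegree + ∑ i ∈ Finset.range p.natDegree, C (a i) * X ^ i,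
      monic_X_pow_add ?_, ?_⟩
    · refine lt_of_le_of_lt (degree_sum_le _ _) ?_
      rw [Finset.sup_lt_iff (by simp [bot_lt_iff_ne_bot])]
      intro i hi
      refine lt_of_le_of_lt (degree_C_mul_X_pow_le _ _) ?_
      exact_mod_cast Finset.mem_range.1 hi
    · have h : ∀ i ∈ Finset.range p.natDegree,
          (algebraMap (reesAlgebra I) R[X]) (a i) * (C f * X) ^ i
            = C (p.coeff i * f ^ i) * X ^ p.natDegree := by
        intro i hi
        have hi' : p.natDegree - i + i = p.natDegree :=
          Nat.sub_add_cancel (Finset.mem_range.1 hi).le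
        change monomial (p.natDegree - i) (p.coeff i) * (C f * X) ^ i = _
        rw [← C_mul_X_pow_eq_monomial, mul_pow, ← C_pow, C_mul]
        nth_rewrite 2 [← hi']
        rw [pow_add]
        ring
      rw [eval₂_add, eval₂_X_pow, eval₂_finsetSum]
      simp only [eval₂_mul, eval₂_C, eval₂_X_pow]
      rw [Finset.sum_congr rfl h, ← Finset.sum_mul, mul_pow, ← C_pow, ← add_mul, ← map_sum,
        ← C_add]
      rw [eval_eq_sum_range, Finset.sum_range_succ, hp.coeff_natDegree, one_mul, add_comm] at he
      rw [he, C_0, zero_mul]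
  · rintro ⟨q, hq, he⟩
    rcases subsingleton_or_nontrivial R with hR | hR
    · exact ⟨0, Subsingleton.elim _ _, Subsingleton.elim _ _, fun i => by simp⟩
    have hd : ∀ i ≤ q.natDegree,
        ((algebraMap (reesAlgebra I) R[X]) (q.coeff i) * (C f * X) ^ i).coeff q.natDegree
          = (q.coeff i : R[X]).coeff (q.natDegree - i) * f ^ i := by
      intro i hi
      change ((q.coeff i : R[X]) * (C f * X) ^ i).coeff q.natDegree = _
      rw [mul_pow, ← C_pow, mul_left_comm, coeff_C_mul, coeff_mul_X_pow', if_pos hi, mul_comm]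
    let r : R[X] := ∑ i ∈ Finset.range q.natDegree,
      C ((q.coeff i : R[X]).coeff (q.natDegree - i)) * X ^ i
    have hr : r.degree < q.natDegree := by
      refine lt_of_le_of_lt (degree_sum_le _ _) ?_
      rw [Finset.sup_lt_iff (by simp [bot_lt_iff_ne_bot])]
      intro i hi
      refine lt_of_le_of_lt (degree_C_mul_X_pow_le _ _) ?_
      exact_mod_cast Finset.mem_range.1 hi
    have hdeg : (X ^ q.natDegree + r).natDegree = q.natDegree := by
      refine natDegree_eq_of_degree_eq_some ?_
      rw [degree_add_eq_left_of_degree_lt (by rwa [degree_X_pow]), degree_X_pow]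
    refine ⟨X ^ q.natDegree + r, monic_X_pow_add hr, ?_, fun i => ?_⟩
    · have h := congrArg (fun g : R[X] => g.coeff q.natDegree) he
      simp only [eval₂_eq_sum_range, finsetSum_coeff, coeff_zero] at h
      rw [Finset.sum_range_succ, hd _ le_rfl,
        Finset.sum_congr rfl fun i hi => hd i (Finset.mem_range.1 hi).le] at h
      have h1 : (q.coeff q.natDegree : R[X]).coeff (q.natDegree - q.natDegree) = 1 := by
        rw [hq.coeff_natDegree]
        simp
      rw [h1, one_mul, add_comm] at h
      simpa [r, eval_finsetSum] using h
    · rw [hdeg, coeff_add, coeff_X_pow]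
      refine Ideal.add_mem _ ?_ ?_
      · split_ifs with hi
        · simp [hi]
        · simp
      · simp only [r, finsetSum_coeff, coeff_C_mul, coeff_X_pow]
        refine Ideal.sum_mem _ fun j _ => ?_
        split_ifs with hij
        · rw [mul_one, hij]
          exact (mem_reesAlgebra_iff I _).1 (q.coeff j).2 _
        · simp

/-- The integral closure of an ideal: the set of all elements that are integral over it. -/
def idealIntegralClosure {R : Type*} [CommRing R] (I : Ideal R) : Ideal R where
  carrier := {f | IsIntegralOverIdeal I f}
  zero_mem' := by
    rw [Set.mem_ofPred_eq, isIntegralOverIdeal_iff]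
    simpa using isIntegral_zero
  add_mem' {a b} ha hb := by
    rw [Set.mem_ofPred_eq, isIntegralOverIdeal_iff] at *
    rw [map_add, add_mul]
    exact ha.add hb
  smul_mem' c f hf := by
    rw [Set.mem_ofPred_eq, isIntegralOverIdeal_iff] at *
    have h : IsIntegral (reesAlgebra I) (Polynomial.C c : Polynomial R) :=
      isIntegral_algebraMap (R := reesAlgebra I)
        (x := ⟨Polynomial.C c, (reesAlgebra I).algebraMap_mem c⟩)
    rw [smul_eq_mul, map_mul, mul_assoc]
    exact h.mul hf

/-! ### Stanley decompositions and Stanley depth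

`M` is a module over `S = K[x₁, …, xₙ]`, and `𝓜 a`, for `a ∈ ℤⁿ`, is the homogeneous component
of `M` of degree `a`. -/

section Stanley

variable (K : Type*) [Field K] {n : ℕ}
  {M : Type*} [AddCommGroup M] [Module K M] [Module (MvPolynomial (Fin n) K) M]

/-- The `K`-subspace `u K[Z]` of `M`, spanned by all `v • u` with `v` a monomial in `K[Z]`. -/
def stanleySpace (u : M) (Z : Finset (Fin n)) : Submodule K M :=
  Submodule.span K
    {m | ∃ e : Fin n →₀ ℕ, e.support ⊆ Z ∧ m = MvPolynomial.monomial e (1 : K) • u}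

variable {K}

/-- A Stanley decomposition of the `ℤⁿ`-graded module `M = ⨁ 𝓜 a`: a decomposition of `M` into a
finite direct sum of Stanley spaces `uⱼ K[Zⱼ]`. -/
structure StanleyDecomposition (𝓜 : (Fin n → ℤ) → Submodule K M) where
  /-- the number of summands -/
  r : ℕ
  /-- the generators of the Stanley spaces -/
  u : Fin r → M
  /-- the sets of variables of the Stanley spaces -/
  Z : Fin r → Finset (Fin n)
  /-- the generators are homogeneous -/
  homogeneous : ∀ j, ∃ a, u j ∈ 𝓜 a
  /-- each `uⱼ K[Zⱼ]` is a free `K[Zⱼ]`-module, with basis `uⱼ` -/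
  free : ∀ j, ∀ p ∈ MvPolynomial.supported K (Z j : Set (Fin n)), p • u j = 0 → p = 0
  /-- `M` is the (internal) direct sum of the subspaces `uⱼ K[Zⱼ]` -/
  directSum : DirectSum.IsInternal fun j => stanleySpace K (u j) (Z j)

/-- The Stanley depth of a Stanley decomposition: the least dimension of its Stanley spaces
(`∞` for the empty decomposition of the zero module). -/
noncomputable def StanleyDecomposition.sdepth {𝓜 : (Fin n → ℤ) → Submodule K M}
    (D : StanleyDecomposition 𝓜) : ℕ∞ :=
  ⨅ j, ((D.Z j).card : ℕ∞)

/-- The Stanley depth of `M = ⨁ 𝓜 a`: the largest Stanley depth of a Stanley decomposition. -/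
noncomputable def sdepth (𝓜 : (Fin n → ℤ) → Submodule K M) : ℕ∞ :=
  ⨆ D : StanleyDecomposition 𝓜, D.sdepth

end Stanley

/-! ### The multigrading on `S`, on ideals and on quotients by ideals -/

section Multigrading

variable {K : Type*} [Field K] {n : ℕ}

/-- The homogeneous component of `S = K[x₁, …, xₙ]` of degree `a ∈ ℤⁿ`, where `xᵢ` has
degree the `i`-th unit vector. -/
noncomputable def multigradedPiece (K : Type*) [Field K] {n : ℕ} (a : Fin n → ℤ) :
    Submodule K (MvPolynomial (Fin n) K) :=
  MvPolynomial.weightedHomogeneousSubmodule K (fun i => (Pi.single i 1 : Fin n → ℤ)) a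

/-- The homogeneous component of degree `a` of a (monomial) ideal `J`, as a module. -/
noncomputable def idealPiece (J : Ideal (MvPolynomial (Fin n) K)) (a : Fin n → ℤ) :
    Submodule K J :=
  (multigradedPiece K a).comap (J.subtype.restrictScalars K)

/-- The homogeneous component of degree `a` of `S ⧸ J`, for a (monomial) ideal `J`. -/
noncomputable def quotientPiece (J : Ideal (MvPolynomial (Fin n) K)) (a : Fin n → ℤ) :
    Submodule K (MvPolynomial (Fin n) K ⧸ J) :=
  (multigradedPiece K a).map (Ideal.Quotient.mkₐ K J).toLinearMap

/-- The Stanley depth of a (monomial) ideal. -/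
noncomputable def sdepthIdeal (J : Ideal (MvPolynomial (Fin n) K)) : ℕ∞ :=
  sdepth (idealPiece J)

/-- The Stanley depth of `S ⧸ J`, for a (monomial) ideal `J`. -/
noncomputable def sdepthQuotient (J : Ideal (MvPolynomial (Fin n) K)) : ℕ∞ :=
  sdepth (quotientPiece J)

/-! ### Complete intersection monomial ideals -/

/-- The ideal of `S` generated by the monomials with exponent vectors in `G`. -/
noncomputable def monomialIdeal (K : Type*) [Field K] {n : ℕ} (G : Finset (Fin n →₀ ℕ)) :
    Ideal (MvPolynomial (Fin n) K) :=
  Ideal.span ((fun e => MvPolynomial.monomial e (1 : K)) '' (G : Set (Fin n →₀ ℕ)))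

/-- `I` is a monomial ideal which is minimally generated by `t` monomials: some set of `t`
monomials generates `I`, and none of its proper subsets does. -/
def IsMinimallyGeneratedByMonomials (I : Ideal (MvPolynomial (Fin n) K)) (t : ℕ) : Prop :=
  ∃ G : Finset (Fin n →₀ ℕ), G.card = t ∧ Minimal (fun H => monomialIdeal K H = I) G

end Multigrading

/-- An ideal is a complete intersection if it is generated by a regular sequence. -/
def IsCompleteIntersection {R : Type*} [CommRing R] (I : Ideal R) : Prop :=
  ∃ rs : List R, RingTheory.Sequence.IsRegular R rs ∧ Ideal.ofList rs = I

/-! ### Syzygies of regular sequences and of minimal monomial generators -/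

/-! Everything is reduced to the combinatorics of exponent vectors.

Let `G` be the set of minimal monomial generators. Syzygies of a regular sequence have coefficients
in `I`, and this passes to any generating family of the same size, in particular to `G`. Applied to
the syzygy of two generators coming from their lcm, it forces the supports of the generators to be
pairwise disjoint (`IsCompleteIntersection.disjoint_support`).

Choose weights with `w j * g j = L` for `g ∈ G` and `j ∈ g.support`. Then `x ^ a` is integral over
`I ^ k` exactly when the block minima `min_{j ∈ g.support} w j * a j`, summed over `g ∈ G`, reach `k
* L` (`mem_idealIntegralClosure_monomialIdeal_pow_iff`): a monomial valuation gives necessity, an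
explicit power gives sufficiency.

Such a superlevel set and its complement are cut into Stanley cells one block at a time
(`isStanleyPartitionable_sum_blockOrder`). Fixing the minimum of a block and the first place where
it is attained freezes one variable and only bounds the others below. In the complement all `t`
blocks may cost a variable. In the superlevel set the block that reaches the remaining threshold
costs none, so at most `t - 1` are lost.

For the upper bound in (ii), take a monomial outside the closure that enters it on multiplication by
a high power of any one of `t` suitable variables. The Stanley space containing it can use none of
these variables. -/

theorem Ideal.exists_sum_range_of_mem_span_image_Iio {R : Type*} [CommRing R] (f : ℕ → R) (s : ℕ)
    {x : R} (hx : x ∈ Ideal.span (f '' Set.Iio s)) :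
    ∃ c : ℕ → R, x = ∑ i ∈ Finset.range s, c i * f i := by
  induction hx using Submodule.span_induction with
  | mem x h =>
    obtain ⟨i, hi, rfl⟩ := h
    refine ⟨fun j => if j = i then 1 else 0, ?_⟩
    simp only [ite_mul, one_mul, zero_mul]
    rw [Finset.sum_ite_eq' , if_pos (Finset.mem_range.2 hi)]
  | zero => exact ⟨0, by simp⟩
  | add x y _ _ hx hy =>
    obtain ⟨c, rfl⟩ := hx
    obtain ⟨d, rfl⟩ := hy
    exact ⟨c + d, by simp [add_mul, Finset.sum_add_distrib]⟩
  | smul a x _ hx =>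
    obtain ⟨c, rfl⟩ := hx
    exact ⟨fun i => a * c i, by simp [Finset.mul_sum, mul_assoc]⟩

/-- Regularity puts the last coefficient in the ideal of the earlier elements. Expanding it there
turns the relation into a shorter one, with coefficients `a i + c i * f s`, and induction applies.
-/
theorem Ideal.mem_span_of_sum_mul_eq_zero {R : Type*} [CommRing R] (f : ℕ → R) (s : ℕ)
    (h : ∀ i < s, ∀ x, x * f i ∈ Ideal.span (f '' Set.Iio i) → x ∈ Ideal.span (f '' Set.Iio i))
    (a : ℕ → R) (ha : ∑ i ∈ Finset.range s, a i * f i = 0) :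
    ∀ i < s, a i ∈ Ideal.span (f '' Set.Iio s) := by
  induction s generalizing a with
  | zero => intro i hi; omega
  | succ s ih =>
    have hmono : Ideal.span (f '' Set.Iio s) ≤ Ideal.span (f '' Set.Iio (s + 1)) :=
      Ideal.span_mono (Set.image_mono (Set.Iio_subset_Iio (Nat.le_succ s)))
    have hmem : ∀ i < s, f i ∈ Ideal.span (f '' Set.Iio s) := fun i hi =>
      Ideal.subset_span ⟨i, hi, rfl⟩
    rw [Finset.sum_range_succ] at ha
    have hs : a s ∈ Ideal.span (f '' Set.Iio s) := by
      refine h s (Nat.lt_succ_self s) _ ?_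
      rw [← neg_eq_of_add_eq_zero_right ha]
      exact neg_mem (Ideal.sum_mem _ fun i hi =>
        Ideal.mul_mem_left _ _ (hmem i (Finset.mem_range.1 hi)))
    obtain ⟨c, hc⟩ := Ideal.exists_sum_range_of_mem_span_image_Iio f s hs
    have hsum : ∑ i ∈ Finset.range s, (a i + c i * f s) * f i = 0 := by
      rw [← ha, hc, Finset.sum_mul, ← Finset.sum_add_distrib]
      exact Finset.sum_congr rfl fun i _ => by ring
    have hi := ih (fun i hi => h i (hi.trans (Nat.lt_succ_self s))) _ hsum
    intro i hlt
    rcases Nat.lt_succ_iff_lt_or_eq.1 hlt with hlt | rfl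
    · have h1 := hmono (hi i hlt)
      have h2 : c i * f s ∈ Ideal.span (f '' Set.Iio (s + 1)) :=
        Ideal.mul_mem_left _ _ (Ideal.subset_span ⟨s, Nat.lt_succ_self s, rfl⟩)
      simpa using sub_mem h1 h2
    · exact hmono hs

theorem Ideal.ofList_take_eq_span_image {R : Type*} [CommRing R] (rs : List R) (i : ℕ)
    (hi : i ≤ rs.length) :
    Ideal.ofList (rs.take i) = Ideal.span ((fun j => rs.getD j 0) '' Set.Iio i) := by
  unfold Ideal.ofList
  congr 1
  ext x
  simp only [Set.mem_ofPred_eq, List.mem_take_iff_getElem, Set.mem_image, Set.mem_Iio]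
  constructor
  · rintro ⟨j, hj, rfl⟩
    have := lt_min_iff.1 hj
    exact ⟨j, this.1, List.getD_eq_getElem _ _ this.2⟩
  · rintro ⟨j, hj, rfl⟩
    exact ⟨j, lt_min hj (hj.trans_le hi), (List.getD_eq_getElem _ _ (hj.trans_le hi)).symm⟩

/-- Only the syzygy property is retained from regularity: unlike regularity itself, it does not
depend on an order and can be moved to other generators. -/
theorem IsCompleteIntersection.exists_generators {R : Type*} [CommRing R] {I : Ideal R}
    (hI : IsCompleteIntersection I) :
    I ≠ ⊤ ∧ ∃ (s : ℕ) (f : Fin s → R), Ideal.span (Set.range f) = I ∧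
      ∀ a : Fin s → R, ∑ i, a i * f i = 0 → ∀ i, a i ∈ I := by
  obtain ⟨rs, hrs, rfl⟩ := hI
  have hspan : Ideal.ofList rs = Ideal.span ((fun j => rs.getD j 0) '' Set.Iio rs.length) := by
    rw [← Ideal.ofList_take_eq_span_image rs _ le_rfl, List.take_length]
  refine ⟨fun h => hrs.top_ne_smul (by simp [h]), rs.length, fun i => rs.getD i 0, ?_, ?_⟩
  · rw [hspan]
    congr 1
    ext x
    simp only [Set.mem_range, Set.mem_image, Set.mem_Iio]
    exact ⟨fun ⟨i, hi⟩ => ⟨i, i.2, hi⟩, fun ⟨i, hi, hx⟩ => ⟨⟨i, hi⟩, hx⟩⟩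
  · intro a ha i
    rw [hspan]
    let a' : ℕ → R := fun j => if h : j < rs.length then a ⟨j, h⟩ else 0
    have h := Ideal.mem_span_of_sum_mul_eq_zero (fun j => rs.getD j 0) rs.length ?_ a' ?_ i i.2
    · simpa [a'] using h
    · intro j hj x hx
      have hreg := (isSMulRegular_quotient_iff_mem_of_smul_mem _ _).1 (hrs.regular_mod_prev j hj) x
      rw [← Ideal.ofList_take_eq_span_image rs j hj.le] at hx ⊢
      simp only [smul_eq_mul, Ideal.mul_top] at hreg
      refine hreg ?_
      rwa [mul_comm, ← List.getD_eq_getElem _ 0 hj]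
    · rw [Finset.sum_range]
      simpa [a'] using ha

open scoped Matrix in
-- Write `u = A f` and `f = B u`. The rows of `B A - 1` are syzygies of `f`, so `B A = 1` modulo
-- `I`, and equal cardinality gives `A B = 1` there as well. For a syzygy `a` of `u`, the vector `a
-- A` is a syzygy of `f`, hence `a = (a A) B` vanishes modulo `I`.
theorem Ideal.syzygy_mem_of_syzygy_mem {R ι κ : Type*} [CommRing R] [Fintype ι] [Fintype κ]
    (hcard : Fintype.card ι = Fintype.card κ) {I : Ideal R} {f : κ → R} {u : ι → R}
    (hf : Ideal.span (Set.range f) = I) (hu : Ideal.span (Set.range u) = I)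
    (h : ∀ a : κ → R, ∑ i, a i * f i = 0 → ∀ i, a i ∈ I) (a : ι → R)
    (ha : ∑ i, a i * u i = 0) (i : ι) : a i ∈ I := by
  classical
  have hA : ∀ i, ∃ c : κ → R, ∑ j, c j * f j = u i := fun i => by
    have : u i ∈ Ideal.span (Set.range f) := by rw [hf, ← hu]; exact Ideal.subset_span ⟨i, rfl⟩
    exact Ideal.mem_span_range_iff_exists_fun.1 this
  have hB : ∀ j, ∃ c : ι → R, ∑ i, c i * u i = f j := fun j => by
    have : f j ∈ Ideal.span (Set.range u) := by rw [hu, ← hf]; exact Ideal.subset_span ⟨j, rfl⟩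
    exact Ideal.mem_span_range_iff_exists_fun.1 this
  choose A hA using hA
  choose B hB using hB
  have hAu : Matrix.of A *ᵥ f = u := funext hA
  have hBf : Matrix.of B *ᵥ u = f := funext hB
  let q := Ideal.Quotient.mk I
  have hBA : (Matrix.of B).map q * (Matrix.of A).map q = 1 := by
    rw [← Matrix.map_mul]
    ext j l
    have h0 := h ((Matrix.of B * Matrix.of A - 1 : Matrix κ κ R) j) ?_ l
    · rw [Matrix.sub_apply, ← Ideal.Quotient.eq_zero_iff_mem, map_sub, sub_eq_zero] at h0
      rw [Matrix.map_apply]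
      refine h0.trans ?_
      rw [Matrix.one_apply, Matrix.one_apply]
      split_ifs <;> simp
    · change ((Matrix.of B * Matrix.of A - 1) *ᵥ f) j = 0
      rw [Matrix.sub_mulVec, ← Matrix.mulVec_mulVec, hAu, hBf, Matrix.one_mulVec, sub_self,
        Pi.zero_apply]
  have hAB : (Matrix.of A).map q * (Matrix.of B).map q = 1 :=
    (Matrix.mul_eq_one_comm_of_card_eq κ ι _ hcard.symm).1 hBA
  have haA : (q ∘ a) ᵥ* (Matrix.of A).map q = 0 := by
    ext j
    have h0 := h (a ᵥ* Matrix.of A) ?_ j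
    · rw [← Ideal.Quotient.eq_zero_iff_mem] at h0
      rw [Pi.zero_apply, ← h0]
      simp [q, Matrix.vecMul, dotProduct]
    · change (a ᵥ* Matrix.of A) ⬝ᵥ f = 0
      rw [← Matrix.dotProduct_mulVec, hAu]
      exact ha
  have h1 : (q ∘ a) ᵥ* ((Matrix.of A).map q * (Matrix.of B).map q) = 0 := by
    rw [← Matrix.vecMul_vecMul, haA, Matrix.zero_vecMul]
  rw [hAB, Matrix.vecMul_one] at h1
  exact Ideal.Quotient.eq_zero_iff_mem.1 (congrFun h1 i)

/-! ### Minimal monomial generators of a complete intersection -/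

section MonomialGenerators

variable {K : Type*} [Field K] {n : ℕ}

open MvPolynomial

theorem mem_monomialIdeal_iff {G : Finset (Fin n →₀ ℕ)} {f : MvPolynomial (Fin n) K} :
    f ∈ monomialIdeal K G ↔ ∀ a ∈ f.support, ∃ g ∈ G, g ≤ a := by
  unfold monomialIdeal
  rw [mem_ideal_span_monomial_image]
  rfl

theorem monomial_mem_monomialIdeal_iff {G : Finset (Fin n →₀ ℕ)} {a : Fin n →₀ ℕ} :
    monomial a (1 : K) ∈ monomialIdeal K G ↔ ∃ g ∈ G, g ≤ a := by
  rw [mem_monomialIdeal_iff]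
  simp

theorem eq_of_le_of_minimal_monomialIdeal {I : Ideal (MvPolynomial (Fin n) K)}
    {G : Finset (Fin n →₀ ℕ)} (hG : Minimal (fun H => monomialIdeal K H = I) G)
    {g h : Fin n →₀ ℕ} (hg : g ∈ G) (hh : h ∈ G) (hle : g ≤ h) : g = h := by
  by_contra hne
  have hsub : G.erase h ⊆ G := Finset.erase_subset _ _
  have heq : monomialIdeal K (G.erase h) = I := by
    rw [← hG.prop]
    ext f
    rw [mem_monomialIdeal_iff, mem_monomialIdeal_iff]
    refine forall₂_congr fun a _ => ⟨fun ⟨b, hb, hba⟩ => ⟨b, hsub hb, hba⟩, fun ⟨b, hb, hba⟩ => ?_⟩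
    by_cases hbh : b = h
    · exact ⟨g, Finset.mem_erase.2 ⟨hne, hg⟩, hle.trans (hbh ▸ hba)⟩
    · exact ⟨b, Finset.mem_erase.2 ⟨hbh, hb⟩, hba⟩
  exact Finset.notMem_erase h G (hG.le_of_le heq hsub hh)

open scoped Matrix in
/-- Any generating family of a proper monomial ideal whose syzygies have coefficients in the ideal
has as many members as the minimal set of monomial generators. -/
theorem card_eq_of_minimal_monomialIdeal {κ : Type*} [Fintype κ]
    {I : Ideal (MvPolynomial (Fin n) K)} (hI : I ≠ ⊤) {f : κ → MvPolynomial (Fin n) K}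
    (hf : Ideal.span (Set.range f) = I)
    (h : ∀ a : κ → MvPolynomial (Fin n) K, ∑ i, a i * f i = 0 → ∀ i, a i ∈ I)
    {G : Finset (Fin n →₀ ℕ)} (hG : Minimal (fun H => monomialIdeal K H = I) G) :
    Fintype.card G = Fintype.card κ := by
  classical
  let u : G → MvPolynomial (Fin n) K := fun g => monomial (g : Fin n →₀ ℕ) 1
  have hu : Ideal.span (Set.range u) = I := by
    rw [← hG.prop, monomialIdeal]
    congr 1
    ext x
    simp [u]
  have hA : ∀ i, ∃ c : κ → _, ∑ j, c j * f j = u i := fun i => by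
    have : u i ∈ Ideal.span (Set.range f) := by rw [hf, ← hu]; exact Ideal.subset_span ⟨i, rfl⟩
    exact Ideal.mem_span_range_iff_exists_fun.1 this
  have hB : ∀ j, ∃ c : G → _, ∑ i, c i * u i = f j := fun j => by
    have : f j ∈ Ideal.span (Set.range u) := by rw [hu, ← hf]; exact Ideal.subset_span ⟨j, rfl⟩
    exact Ideal.mem_span_range_iff_exists_fun.1 this
  choose A hA using hA
  choose B hB using hB
  have hAu : Matrix.of A *ᵥ f = u := funext hA
  have hBf : Matrix.of B *ᵥ u = f := funext hB
  -- A proper monomial ideal has no constant terms, so `q` factors through the quotient by `I`. Over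
  -- the field `K` the two transition matrices become mutually inverse, which forces them to be
  -- square.
  let q : MvPolynomial (Fin n) K →+* K := constantCoeff
  have hIq : ∀ x ∈ I, q x = 0 := by
    intro x hx
    rw [← hG.prop, mem_monomialIdeal_iff] at hx
    by_contra hne
    obtain ⟨g, hg, hg0⟩ := hx 0 (mem_support_iff.2 hne)
    refine hI ((Ideal.eq_top_iff_one _).2 ?_)
    rw [← hG.prop, show (1 : MvPolynomial (Fin n) K) = monomial 0 1 from rfl,
      monomial_mem_monomialIdeal_iff]
    exact ⟨g, hg, hg0⟩
  refine Matrix.square_of_invertible ((Matrix.of A).map q) ((Matrix.of B).map q) ?_ ?_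
  · rw [← Matrix.map_mul]
    ext i l
    have h1 : ((Matrix.of A * Matrix.of B) *ᵥ u) i = u i := by
      rw [← Matrix.mulVec_mulVec, hBf, hAu]
    -- In the coefficient of `x ^ l` only the generator `l` itself contributes, since no other
    -- minimal generator divides it. What remains is the constant term of the matrix entry.
    have h2 := congrArg (coeff (l : Fin n →₀ ℕ)) h1
    simp only [Matrix.mulVec, dotProduct, coeff_sum, u, coeff_mul_monomial', coeff_monomial,
      mul_one] at h2
    rw [Finset.sum_eq_single l] at h2
    · rw [if_pos le_rfl, tsub_self] at h2
      rw [Matrix.map_apply]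
      refine h2.trans ?_
      rw [Matrix.one_apply]
      simp only [Subtype.ext_iff]
    · intro b _ hb
      refine if_neg fun hle => hb ?_
      exact Subtype.ext (eq_of_le_of_minimal_monomialIdeal hG b.2 l.2 hle)
    · exact fun h => absurd (Finset.mem_univ _) h
  · rw [← Matrix.map_mul]
    ext j l
    have h0 := h ((Matrix.of B * Matrix.of A - 1 : Matrix κ κ _) j) ?_ l
    · have h0 := hIq _ h0
      rw [Matrix.sub_apply, map_sub, sub_eq_zero] at h0
      rw [Matrix.map_apply]
      refine h0.trans ?_
      rw [Matrix.one_apply, Matrix.one_apply]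
      split_ifs <;> simp
    · change ((Matrix.of B * Matrix.of A - 1) *ᵥ f) j = 0
      rw [Matrix.sub_mulVec, ← Matrix.mulVec_mulVec, hAu, hBf, Matrix.one_mulVec, sub_self,
        Pi.zero_apply]

/-- The minimal monomial generators of a complete intersection have pairwise disjoint supports. -/
theorem IsCompleteIntersection.disjoint_support {I : Ideal (MvPolynomial (Fin n) K)}
    (hci : IsCompleteIntersection I) {G : Finset (Fin n →₀ ℕ)}
    (hG : Minimal (fun H => monomialIdeal K H = I) G) :
    (∀ g ∈ G, g ≠ 0) ∧ ∀ g ∈ G, ∀ h ∈ G, g ≠ h → Disjoint g.support h.support := by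
  classical
  obtain ⟨hI, s, f, hf, hsyz⟩ := hci.exists_generators
  constructor
  · rintro g hg rfl
    refine hI ((Ideal.eq_top_iff_one _).2 ?_)
    rw [← hG.prop, show (1 : MvPolynomial (Fin n) K) = monomial 0 1 from rfl,
      monomial_mem_monomialIdeal_iff]
    exact ⟨0, hg, le_rfl⟩
  intro g hg h hh hne
  let u : G → MvPolynomial (Fin n) K := fun g => monomial (g : Fin n →₀ ℕ) 1
  have hu : Ideal.span (Set.range u) = I := by
    rw [← hG.prop, monomialIdeal]
    congr 1
    ext x
    simp [u]
  have hcard := card_eq_of_minimal_monomialIdeal hI hf hsyz hG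
  let g' : G := ⟨g, hg⟩
  let h' : G := ⟨h, hh⟩
  have hgh' : g' ≠ h' := fun e => hne (congrArg Subtype.val e)
  -- The syzygy from the lcm puts `x ^ (h - g ⊓ h)` in `I`. A generator dividing it divides `x ^ h`,
  -- so it is `h`, and `h ≤ h - g ⊓ h` leaves no common variable.
  have hmem := Ideal.syzygy_mem_of_syzygy_mem hcard hf hu hsyz
    (Pi.single g' (monomial (h - g ⊓ h) 1) - Pi.single h' (monomial (g - g ⊓ h) 1)) ?_ g'
  · simp only [Pi.sub_apply, Pi.single_eq_same, Pi.single_eq_of_ne hgh', sub_zero] at hmem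
    rw [← hG.prop, monomial_mem_monomialIdeal_iff] at hmem
    obtain ⟨b, hb, hbh⟩ := hmem
    have hbeq := eq_of_le_of_minimal_monomialIdeal hG hb hh (hbh.trans tsub_le_self)
    rw [Finset.disjoint_left]
    intro j hj1 hj2
    have h1 := hbh j
    rw [hbeq] at h1
    simp only [Finsupp.mem_support_iff] at hj1 hj2
    simp only [Finsupp.tsub_apply, Finsupp.inf_apply] at h1
    omega
  · simp only [Pi.sub_apply, sub_mul, Finset.sum_sub_distrib, Pi.single_apply, ite_mul, zero_mul,
      Finset.sum_ite_eq', Finset.mem_univ, if_true, u, monomial_mul, one_mul]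
    rw [sub_eq_zero]
    congr 2
    ext j
    simp only [g', h', Finsupp.add_apply, Finsupp.tsub_apply, Finsupp.inf_apply]
    omega

end MonomialGenerators

/-! ### Partitions of sets of exponent vectors into Stanley cells -/

section Partition

variable {n : ℕ}

/-- The exponent vectors of the monomials in the Stanley space `x ^ p * K[Z]`. -/
def stanleyCell (p : Fin n →₀ ℕ) (Z : Finset (Fin n)) : Set (Fin n →₀ ℕ) :=
  {a | ∀ j, p j ≤ a j ∧ (j ∉ Z → a j = p j)}

/-- `A` is a finite disjoint union of Stanley cells of dimension at least `d`. -/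
inductive IsStanleyPartitionable (d : ℕ) : Set (Fin n →₀ ℕ) → Prop
  | empty : IsStanleyPartitionable d ∅
  | cell (p : Fin n →₀ ℕ) (Z : Finset (Fin n)) (h : d ≤ Z.card) :
      IsStanleyPartitionable d (stanleyCell p Z)
  | union (A B : Set (Fin n →₀ ℕ)) (h : Disjoint A B) (hA : IsStanleyPartitionable d A)
      (hB : IsStanleyPartitionable d B) : IsStanleyPartitionable d (A ∪ B)

theorem IsStanleyPartitionable.of_fibers {d : ℕ} {ι : Type*} (s : Finset ι)
    (f : (Fin n →₀ ℕ) → ι) {A : Set (Fin n →₀ ℕ)} (hf : ∀ a ∈ A, f a ∈ s)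
    (h : ∀ i ∈ s, IsStanleyPartitionable d {a | a ∈ A ∧ f a = i}) :
    IsStanleyPartitionable d A := by
  classical
  induction s using Finset.induction_on generalizing A with
  | empty =>
    rw [Set.eq_empty_of_forall_notMem fun a ha => Finset.notMem_empty _ (hf a ha)]
    exact .empty
  | insert i s hi ih =>
    have hA : A = {a | a ∈ A ∧ f a = i} ∪ {a | a ∈ A ∧ f a ≠ i} := by
      ext a
      by_cases hfa : f a = i <;> simp [hfa]
    rw [hA]
    refine .union _ _ ?_ (h i (Finset.mem_insert_self i s)) (ih ?_ ?_)
    · exact Set.disjoint_left.2 fun a ha hb => hb.2 ha.2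
    · rintro a ⟨ha, hne⟩
      exact (Finset.mem_insert.1 (hf a ha)).resolve_left hne
    · intro j hj
      have := h j (Finset.mem_insert_of_mem hj)
      convert this using 1
      ext a
      simp only [Set.mem_ofPred_eq]
      constructor
      · exact fun h => ⟨h.1.1, h.2⟩
      · exact fun h => ⟨⟨h.1, fun e => hi (e ▸ h.2 ▸ hj)⟩, h.2⟩

theorem IsStanleyPartitionable.exists_cells {d : ℕ} {A : Set (Fin n →₀ ℕ)}
    (h : IsStanleyPartitionable d A) :
    ∃ (r : ℕ) (p : Fin r → Fin n →₀ ℕ) (Z : Fin r → Finset (Fin n)),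
      (∀ i, d ≤ (Z i).card) ∧ (Pairwise fun i j => Disjoint (stanleyCell (p i) (Z i))
        (stanleyCell (p j) (Z j))) ∧ ⋃ i, stanleyCell (p i) (Z i) = A := by
  induction h with
  | empty => exact ⟨0, Fin.elim0, Fin.elim0, fun i => i.elim0, fun i => i.elim0, by simp⟩
  | cell p Z h =>
    exact ⟨1, fun _ => p, fun _ => Z, fun _ => h, fun i j hij => absurd (Subsingleton.elim i j) hij,
      Set.iUnion_const _⟩
  | union A B hAB _ _ hA hB =>
    obtain ⟨r, p, Z, hd, hp, hu⟩ := hA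
    obtain ⟨r', p', Z', hd', hp', hu'⟩ := hB
    have hsub : ∀ i, stanleyCell (p i) (Z i) ⊆ A := fun i => hu ▸ Set.subset_iUnion (fun i => stanleyCell (p i) (Z i)) i
    have hsub' : ∀ i, stanleyCell (p' i) (Z' i) ⊆ B := fun i => hu' ▸
      Set.subset_iUnion (fun i => stanleyCell (p' i) (Z' i)) i
    refine ⟨r + r', Fin.append p p', Fin.append Z Z', ?_, ?_, ?_⟩
    · intro i
      refine Fin.addCases (fun i => ?_) (fun i => ?_) i
      · rw [Fin.append_left]; exact hd i
      · rw [Fin.append_right]; exact hd' i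
    · intro i j
      refine Fin.addCases (fun i => ?_) (fun i => ?_) i <;>
        refine Fin.addCases (fun j => ?_) (fun j => ?_) j <;>
        simp only [Fin.append_left, Fin.append_right] <;> intro hij
      · exact hp fun e => hij (e ▸ rfl)
      · exact hAB.mono (hsub i) (hsub' j)
      · exact hAB.symm.mono (hsub' i) (hsub j)
      · exact hp' fun e => hij (e ▸ rfl)
    · rw [← hu, ← hu']
      ext a
      simp only [Set.mem_iUnion, Set.mem_union]
      constructor
      · rintro ⟨i, hi⟩
        revert hi
        refine Fin.addCases (fun i => ?_) (fun i => ?_) i <;>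
          simp only [Fin.append_left, Fin.append_right] <;> intro hi
        · exact .inl ⟨i, hi⟩
        · exact .inr ⟨i, hi⟩
      · rintro (⟨i, hi⟩ | ⟨i, hi⟩)
        · exact ⟨Fin.castAdd r' i, by simpa using hi⟩
        · exact ⟨Fin.natAdd r i, by simpa using hi⟩

/-- The least of the weights `w j * a j` of the entries of `a` with index in the block `S`. -/
noncomputable def blockOrder (w : Fin n → ℕ) (S : Finset (Fin n)) (a : Fin n →₀ ℕ) : ℕ :=
  sInf ((fun j => w j * a j) '' (S : Set (Fin n)))

theorem exists_blockOrder_eq (w : Fin n → ℕ) {S : Finset (Fin n)} (hS : S.Nonempty)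
    (a : Fin n →₀ ℕ) : ∃ j ∈ S, w j * a j = blockOrder w S a :=
  Nat.sInf_mem ((Finset.coe_nonempty.2 hS).image _)

theorem blockOrder_le (w : Fin n → ℕ) {S : Finset (Fin n)} {j : Fin n} (hj : j ∈ S)
    (a : Fin n →₀ ℕ) : blockOrder w S a ≤ w j * a j :=
  Nat.sInf_le ⟨j, hj, rfl⟩

theorem le_blockOrder_iff (w : Fin n → ℕ) {S : Finset (Fin n)} (hS : S.Nonempty)
    (a : Fin n →₀ ℕ) (c : ℕ) : c ≤ blockOrder w S a ↔ ∀ j ∈ S, c ≤ w j * a j := by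
  refine ⟨fun h j hj => h.trans (blockOrder_le w hj a), fun h => ?_⟩
  obtain ⟨j, hj, e⟩ := exists_blockOrder_eq w hS a
  exact e ▸ h j hj

/-- The first index in `S` at which the least weight is attained. -/
theorem exists_first_blockOrder_eq (w : Fin n → ℕ) {S : Finset (Fin n)} (hS : S.Nonempty)
    (a : Fin n →₀ ℕ) : ∃ j ∈ S, w j * a j = blockOrder w S a ∧
      ∀ i ∈ S, i < j → blockOrder w S a < w i * a i := by
  classical
  have hne : (S.filter fun j => w j * a j = blockOrder w S a).Nonempty := by
    obtain ⟨j, hj, e⟩ := exists_blockOrder_eq w hS a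
    exact ⟨j, Finset.mem_filter.2 ⟨hj, e⟩⟩
  have hmem := Finset.mem_filter.1 (Finset.min'_mem _ hne)
  refine ⟨_, hmem.1, hmem.2, fun i hi hlt => lt_of_le_of_ne (blockOrder_le w hi a) fun e => ?_⟩
  exact absurd (Finset.min'_le _ i (Finset.mem_filter.2 ⟨hi, e.symm⟩)) (not_le.2 hlt)

/-- A lower bound on a minimum is a separate lower bound `⌈c / w j⌉` on each coordinate, so no free
direction is lost. -/
theorem stanleyCell_inter_le_blockOrder (w : Fin n → ℕ) {S Z : Finset (Fin n)} (hS : S.Nonempty)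
    (hSZ : S ⊆ Z) (hw : ∀ j ∈ S, 0 < w j) (p : Fin n →₀ ℕ) (hp : ∀ j ∈ S, p j = 0) (c : ℕ) :
    ∃ q : Fin n →₀ ℕ, {a | a ∈ stanleyCell p Z ∧ c ≤ blockOrder w S a} = stanleyCell q Z := by
  classical
  refine ⟨Finsupp.equivFunOnFinite.symm fun j => if j ∈ S then c ⌈/⌉ w j else p j, ?_⟩
  ext a
  simp only [Set.mem_ofPred_eq, le_blockOrder_iff w hS, stanleyCell, Finsupp.coe_equivFunOnFinite_symm]
  constructor
  · rintro ⟨h1, h2⟩ j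
    split_ifs with hj
    · exact ⟨(ceilDiv_le_iff_le_mul (hw j hj)).2 (h2 j hj), fun h => absurd (hSZ hj) h⟩
    · exact h1 j
  · intro h
    refine ⟨fun j => ?_, fun j hj => ?_⟩
    · by_cases hj : j ∈ S
      · exact ⟨by simp [hp j hj], fun h => absurd (hSZ hj) h⟩
      · simpa [hj] using h j
    · have := (h j).1
      rw [if_pos hj] at this
      exact (ceilDiv_le_iff_le_mul (hw j hj)).1 this

/-- Naming the first minimizer `j` makes "the minimum is `c`" coordinatewise: `a j = c / w j`, with
bounds `⌈(c + 1) / w i⌉` before `j` and `⌈c / w i⌉` after it. The set is empty unless `w j ∣ c`.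
Since `q` agrees with `p` off `S`, later blocks still start at `0`. -/
theorem stanleyCell_inter_first_blockOrder (w : Fin n → ℕ) {S Z : Finset (Fin n)}
    (hSZ : S ⊆ Z) (hw : ∀ j ∈ S, 0 < w j) (p : Fin n →₀ ℕ) (hp : ∀ j ∈ S, p j = 0) (c : ℕ)
    {j : Fin n} (hj : j ∈ S) :
    {a | a ∈ stanleyCell p Z ∧ blockOrder w S a = c ∧ w j * a j = c ∧
      ∀ i ∈ S, i < j → c < w i * a i} = ∅ ∨
    ∃ q : Fin n →₀ ℕ, (∀ i ∉ S, q i = p i) ∧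
      {a | a ∈ stanleyCell p Z ∧ blockOrder w S a = c ∧ w j * a j = c ∧
      ∀ i ∈ S, i < j → c < w i * a i} = stanleyCell q (Z.erase j) := by
  classical
  by_cases hc : w j ∣ c
  swap
  · left
    refine Set.eq_empty_of_forall_notMem ?_
    rintro a ⟨-, -, h, -⟩
    exact hc ⟨_, h.symm⟩
  right
  obtain ⟨m, hm⟩ := hc
  have hS : S.Nonempty := ⟨j, hj⟩
  refine ⟨Finsupp.equivFunOnFinite.symm fun i => if i ∈ S then (if i = j then m else
    if i < j then (c + 1) ⌈/⌉ w i else c ⌈/⌉ w i) else p i, fun i hi => by simp [hi], ?_⟩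
  have hblock : ∀ a : Fin n →₀ ℕ, (blockOrder w S a = c ∧ w j * a j = c ∧
      ∀ i ∈ S, i < j → c < w i * a i) ↔
      a j = m ∧ ∀ i ∈ S, i ≠ j → (if i < j then (c + 1) ⌈/⌉ w i else c ⌈/⌉ w i) ≤ a i := by
    intro a
    constructor
    · rintro ⟨h1, h2, h3⟩
      refine ⟨Nat.eq_of_mul_eq_mul_left (hw j hj) (h2.trans hm), fun i hi hne => ?_⟩
      split_ifs with hlt
      · exact (ceilDiv_le_iff_le_mul (hw i hi)).2 (h3 i hi hlt)
      · exact (ceilDiv_le_iff_le_mul (hw i hi)).2 (h1 ▸ blockOrder_le w hi a)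
    · rintro ⟨h1, h2⟩
      have h3 : w j * a j = c := by rw [h1, hm]
      have h4 : ∀ i ∈ S, i < j → c < w i * a i := fun i hi hlt => by
        have := h2 i hi hlt.ne
        rw [if_pos hlt] at this
        exact (ceilDiv_le_iff_le_mul (hw i hi)).1 this
      refine ⟨le_antisymm (h3 ▸ blockOrder_le w hj a) ((le_blockOrder_iff w hS a c).2 ?_), h3, h4⟩
      intro i hi
      rcases lt_trichotomy i j with hlt | rfl | hlt
      · exact (h4 i hi hlt).le
      · exact h3.ge
      · have := h2 i hi hlt.ne'
        rw [if_neg hlt.not_gt] at this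
        exact (ceilDiv_le_iff_le_mul (hw i hi)).1 this
  ext a
  simp only [Set.mem_ofPred_eq, hblock, stanleyCell, Finsupp.coe_equivFunOnFinite_symm]
  constructor
  · rintro ⟨h1, h2, h3⟩ i
    by_cases hi : i ∈ S
    · by_cases hij : i = j
      · subst hij
        simp [hi, h2]
      · rw [if_pos hi, if_neg hij]
        exact ⟨h3 i hi hij, fun h => absurd (Finset.mem_erase.2 ⟨hij, hSZ hi⟩) h⟩
    · rw [if_neg hi]
      refine ⟨(h1 i).1, fun h => (h1 i).2 fun hiZ => h (Finset.mem_erase.2 ⟨?_, hiZ⟩)⟩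
      rintro rfl
      exact hi hj
  · intro h
    refine ⟨fun i => ?_, ?_, fun i hi hne => ?_⟩
    · by_cases hi : i ∈ S
      · exact ⟨by simp [hp i hi], fun h => absurd (hSZ hi) h⟩
      · have h1 := h i
        rw [if_neg hi] at h1
        exact ⟨h1.1, fun hiZ => h1.2 fun h => hiZ (Finset.mem_of_mem_erase h)⟩
    · have := (h j).2 (Finset.notMem_erase j Z)
      simpa [hj] using this
    · have := (h i).1
      rwa [if_pos hi, if_neg hne] at this

/-- Induction on the blocks: a block with minimum `c < N` costs one variable and leaves the
threshold `N - c ≥ 1` to the others. The superlevel set saves one variable: when the blocks are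
exhausted the threshold is still positive and nothing remains, so each cell ends at a block that
costs nothing. -/
theorem isStanleyPartitionable_sum_blockOrder (w : Fin n → ℕ) (hw : ∀ j, 0 < w j) (d : ℕ)
    (l : List (Finset (Fin n))) (hl : l.Pairwise Disjoint) (hne : ∀ S ∈ l, S.Nonempty)
    (Z : Finset (Fin n)) (hZ : ∀ S ∈ l, S ⊆ Z) (p : Fin n →₀ ℕ) (hp : ∀ S ∈ l, ∀ j ∈ S, p j = 0)
    (N : ℕ) (hN : 1 ≤ N) :
    (d + l.length ≤ Z.card → IsStanleyPartitionable d
      {a | a ∈ stanleyCell p Z ∧ (l.map fun S => blockOrder w S a).sum < N}) ∧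
    (d + l.length ≤ Z.card + 1 → IsStanleyPartitionable d
      {a | a ∈ stanleyCell p Z ∧ N ≤ (l.map fun S => blockOrder w S a).sum}) := by
  classical
  induction l generalizing Z p N with
  | nil =>
    have h0 : (0 : ℕ) < N := hN
    have h0' : ¬ N ≤ 0 := by omega
    simp only [List.map_nil, List.sum_nil, h0, and_true, h0', and_false, Set.ofPred_false,
      Set.ofPred_mem_eq, List.length_nil, add_zero]
    exact ⟨fun h => .cell p Z h, fun _ => .empty⟩
  | cons S l ih =>
    rw [List.pairwise_cons] at hl
    have hS : S.Nonempty := hne S List.mem_cons_self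
    have hSZ : S ⊆ Z := hZ S List.mem_cons_self
    have hpS : ∀ j ∈ S, p j = 0 := hp S List.mem_cons_self
    simp only [List.map_cons, List.sum_cons, List.length_cons]
    choose F hFS hFeq hFlt using fun a => exists_first_blockOrder_eq w hS a
    -- the part of the cell on which the order along `S` is `c`, and is attained first at `j`
    have key : ∀ c < N, ∀ j ∈ S, ∀ P : ℕ → Prop,
        (∀ q : Fin n →₀ ℕ, (∀ i ∉ S, q i = p i) → IsStanleyPartitionable d
          {a | a ∈ stanleyCell q (Z.erase j) ∧ P (l.map fun S => blockOrder w S a).sum}) →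
        IsStanleyPartitionable d {a | (a ∈ stanleyCell p Z ∧
          P (l.map fun S => blockOrder w S a).sum) ∧ blockOrder w S a = c ∧ F a = j} := by
      intro c _ j hj P hP
      have hF : ∀ a, (blockOrder w S a = c ∧ F a = j) ↔ (blockOrder w S a = c ∧ w j * a j = c ∧
          ∀ i ∈ S, i < j → c < w i * a i) := by
        intro a
        constructor
        · rintro ⟨rfl, rfl⟩
          exact ⟨rfl, hFeq a, hFlt a⟩
        · rintro ⟨rfl, h2, h3⟩
          refine ⟨rfl, ?_⟩
          rcases lt_trichotomy (F a) j with hlt | h | hlt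
          · exact absurd (hFeq a) (h3 _ (hFS a) hlt).ne'
          · exact h
          · exact absurd h2 (hFlt a _ hj hlt).ne'
      have hset : {a | (a ∈ stanleyCell p Z ∧
          P (l.map fun S => blockOrder w S a).sum) ∧ blockOrder w S a = c ∧ F a = j} =
          {a | a ∈ {a | a ∈ stanleyCell p Z ∧ blockOrder w S a = c ∧ w j * a j = c ∧
            ∀ i ∈ S, i < j → c < w i * a i} ∧ P (l.map fun S => blockOrder w S a).sum} := by
        ext a
        simp only [Set.mem_ofPred_eq, hF]
        tauto
      rw [hset]
      rcases stanleyCell_inter_first_blockOrder w hSZ (fun j _ => hw j) p hpS c hj with h | h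
      · rw [h]
        simp only [Set.mem_empty_iff_false, false_and, Set.ofPred_false]
        exact .empty
      · obtain ⟨q, hq, h⟩ := h
        rw [h]
        exact hP q hq
    have hih : ∀ c < N, ∀ j ∈ S, ∀ q : Fin n →₀ ℕ, (∀ i ∉ S, q i = p i) → _ :=
      fun c hc j hj q hq => ih hl.2 (fun T hT => hne T (List.mem_cons_of_mem _ hT)) (Z.erase j)
        (fun T hT i hi => Finset.mem_erase.2 ⟨fun e => Finset.disjoint_left.1 (hl.1 T hT) hj
          (e ▸ hi), hZ T (List.mem_cons_of_mem _ hT) hi⟩) q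
        (fun T hT i hi => (hq i fun hiS => Finset.disjoint_left.1 (hl.1 T hT) hiS hi).trans
          (hp T (List.mem_cons_of_mem _ hT) i hi)) (N - c) (by omega)
    have hcard : ∀ j ∈ S, (Z.erase j).card + 1 = Z.card := fun j hj =>
      Finset.card_erase_add_one (hSZ hj)
    constructor
    · intro hd
      refine .of_fibers (Finset.range N ×ˢ S) (fun a => (blockOrder w S a, F a)) ?_ ?_
      · rintro a ⟨-, ha⟩
        exact Finset.mem_product.2 ⟨Finset.mem_range.2 (by omega), hFS a⟩
      · rintro ⟨c, j⟩ hcj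
        obtain ⟨hc, hj⟩ := Finset.mem_product.1 hcj
        have hc : c < N := Finset.mem_range.1 hc
        have := key c hc j hj (fun m => m < N - c) fun q hq => (hih c hc j hj q hq).1
          (by have := hcard j hj; omega)
        convert this using 1
        ext a
        simp only [Set.mem_ofPred_eq, Prod.mk.injEq]
        constructor
        · rintro ⟨⟨h1, h2⟩, h3, h4⟩
          exact ⟨⟨h1, by omega⟩, h3, h4⟩
        · rintro ⟨⟨h1, h2⟩, h3, h4⟩
          exact ⟨⟨h1, by omega⟩, h3, h4⟩
    · intro hd
      -- The label `none` marks the part where this block alone reaches `N`; it is a single cell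
      -- with all of `Z` free.
      refine .of_fibers (insert none (Finset.image some (Finset.range N ×ˢ S)))
        (fun a => if N ≤ blockOrder w S a then none else some (blockOrder w S a, F a)) ?_ ?_
      · rintro a -
        by_cases h : N ≤ blockOrder w S a
        · simp [h]
        · simp only [h, if_false]
          refine Finset.mem_insert_of_mem (Finset.mem_image_of_mem _ ?_)
          exact Finset.mem_product.2 ⟨Finset.mem_range.2 (by omega), hFS a⟩
      · intro o ho
        rcases Finset.mem_insert.1 ho with rfl | ho
        · obtain ⟨q, hq⟩ := stanleyCell_inter_le_blockOrder w hS hSZ (fun j _ => hw j) p hpS N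
          have := IsStanleyPartitionable.cell (d := d) q Z (by omega)
          rw [← hq] at this
          convert this using 1
          ext a
          simp only [Set.mem_ofPred_eq]
          constructor
          · rintro ⟨⟨h1, -⟩, h3⟩
            refine ⟨h1, ?_⟩
            by_contra h
            simp [h] at h3
          · rintro ⟨h1, h2⟩
            exact ⟨⟨h1, by omega⟩, by simp [h2]⟩
        · obtain ⟨⟨c, j⟩, hcj, rfl⟩ := Finset.mem_image.1 ho
          obtain ⟨hc, hj⟩ := Finset.mem_product.1 hcj
          have hc : c < N := Finset.mem_range.1 hc
          have := key c hc j hj (fun m => N - c ≤ m) fun q hq => (hih c hc j hj q hq).2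
            (by have := hcard j hj; omega)
          convert this using 1
          ext a
          simp only [Set.mem_ofPred_eq]
          constructor
          · rintro ⟨⟨h1, h2⟩, h3⟩
            by_cases h : N ≤ blockOrder w S a
            · simp [h] at h3
            · simp only [h, if_false, Option.some.injEq, Prod.mk.injEq] at h3
              exact ⟨⟨h1, by omega⟩, h3⟩
          · rintro ⟨⟨h1, h2⟩, h3, h4⟩
            have h : ¬ N ≤ blockOrder w S a := by omega
            exact ⟨⟨h1, by omega⟩, by rw [if_neg h, h3, h4]⟩

end Partition

/-! ### The integral closure of powers of a monomial complete intersection -/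

section IntegralClosure

open MvPolynomial

/-- The `T`-adic valuation argument. If `φ f` had exact order `r < N`, each lower term of an
integral equation of degree `m` would have order at least `N * (m - i) + r * i > r * m`, while `φ f
^ m` has order exactly `r * m`. -/
theorem IsIntegralOverIdeal.dvd_of_le_span_pow {R R' : Type*} [CommRing R] [CommRing R']
    [IsDomain R'] {I : Ideal R} {f : R} (h : IsIntegralOverIdeal I f) (φ : R →+* R') {T : R'}
    (hT : Prime T) (N : ℕ) (hI : ∀ x ∈ I, T ^ N ∣ φ x) : T ^ N ∣ φ f := by
  obtain ⟨p, hp, he, hc⟩ := h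
  by_contra hdvd
  -- Without an exact order every power of `T` would divide `φ f`, in particular `T ^ N`.
  have hex : ∃ r, T ^ r ∣ φ f ∧ ¬ T ^ (r + 1) ∣ φ f := by
    by_contra hcon
    push Not at hcon
    refine hdvd ?_
    clear hdvd
    induction N with
    | zero => simp
    | succ N ih => exact hcon _ (ih fun x hx => (pow_dvd_pow T N.le_succ).trans (hI x hx))
  obtain ⟨r, ⟨g, hg⟩, hr⟩ := hex
  have hrN : r < N := by
    by_contra hle
    exact hdvd ((pow_dvd_pow T (not_lt.1 hle)).trans ⟨g, hg⟩)
  have hpow : ∀ s, ∀ x ∈ I ^ s, T ^ (N * s) ∣ φ x := by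
    intro s x hx
    have hle : I ≤ (Ideal.span {T ^ N}).comap φ := fun x hx => by
      rw [Ideal.mem_comap, Ideal.mem_span_singleton]
      exact hI x hx
    have h1 := Ideal.le_comap_pow φ s (Ideal.pow_right_mono hle s hx)
    rw [Ideal.mem_comap, Ideal.span_singleton_pow, Ideal.mem_span_singleton] at h1
    rwa [pow_mul]
  have hsum : φ f ^ p.natDegree =
      -∑ i ∈ Finset.range p.natDegree, φ (p.coeff i) * φ f ^ i := by
    rw [Polynomial.eval_eq_sum_range, Finset.sum_range_succ, hp.coeff_natDegree, one_mul] at he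
    have := congrArg φ he
    simp only [map_add, map_sum, map_mul, map_pow, map_zero] at this
    exact eq_neg_of_add_eq_zero_right this
  have hdiv : T ^ (r * p.natDegree + 1) ∣ φ f ^ p.natDegree := by
    rw [hsum, dvd_neg]
    refine Finset.dvd_sum fun i hi => ?_
    have hi : i < p.natDegree := Finset.mem_range.1 hi
    have h1 := hpow _ _ (hc i)
    have h2 : T ^ (r * i) ∣ φ f ^ i := by
      rw [pow_mul]
      exact pow_dvd_pow_of_dvd ⟨g, hg⟩ i
    refine (pow_dvd_pow T ?_).trans (pow_add T _ _ ▸ mul_dvd_mul h1 h2)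
    obtain ⟨m, hm⟩ := Nat.exists_eq_add_of_lt hi
    have hsub : p.natDegree - i = m + 1 := by omega
    rw [hsub, hm]
    nlinarith
  rw [hg, mul_pow, ← pow_mul, pow_succ] at hdiv
  have := hT.dvd_of_dvd_pow ((mul_dvd_mul_iff_left (pow_ne_zero _ hT.ne_zero)).1 hdiv)
  obtain ⟨g', rfl⟩ := this
  exact hr ⟨g', by rw [hg]; ring⟩

variable {K : Type*} [Field K] {n : ℕ}

/-- The substitution `x j ↦ x j * T ^ v j`, which exhibits the weights of monomials as powers
of `T`. -/
noncomputable def weightHom (K : Type*) [Field K] {n : ℕ} (v : Fin n → ℕ) :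
    MvPolynomial (Fin n) K →ₐ[K] Polynomial (MvPolynomial (Fin n) K) :=
  aeval fun j => Polynomial.C (X j) * Polynomial.X ^ v j

theorem weightHom_monomial (v : Fin n → ℕ) (a : Fin n →₀ ℕ) (c : K) :
    weightHom K v (monomial a c) =
      Polynomial.C (monomial a c) * Polynomial.X ^ (∑ j, v j * a j) := by
  rw [weightHom, aeval_monomial, Finsupp.prod_fintype _ _ (by simp)]
  simp only [mul_pow, Finset.prod_mul_distrib, ← pow_mul, Finset.prod_pow_eq_pow_sum]
  rw [← mul_assoc]
  congr 1
  rw [monomial_eq, Finsupp.prod_fintype _ _ (by simp)]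
  simp only [map_mul, map_prod, map_pow]
  rfl

/-- Each monomial stays visible in the coefficients of the powers of `T`, so terms of equal weight
cannot cancel. -/
theorem le_weight_of_X_pow_dvd_weightHom (v : Fin n → ℕ) (N : ℕ) {f : MvPolynomial (Fin n) K}
    (h : Polynomial.X ^ N ∣ weightHom K v f) {a : Fin n →₀ ℕ} (ha : a ∈ f.support) :
    N ≤ ∑ j, v j * a j := by
  classical
  by_contra hlt
  have h0 := (Polynomial.X_pow_dvd_iff.1 h) _ (not_le.1 hlt)
  rw [← support_sum_monomial_coeff f, map_sum, Polynomial.finsetSum_coeff] at h0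
  have h1 := congrArg (coeff a) h0
  rw [coeff_sum, Finset.sum_eq_single a] at h1
  · rw [weightHom_monomial, Polynomial.coeff_C_mul, Polynomial.coeff_X_pow, if_pos rfl, mul_one,
      coeff_monomial, if_pos rfl] at h1
    exact mem_support_iff.1 ha (by simpa using h1)
  · intro e _ he
    rw [weightHom_monomial, Polynomial.coeff_C_mul, Polynomial.coeff_X_pow]
    split_ifs
    · rw [mul_one, coeff_monomial, if_neg he]
    · simp
  · exact fun h => absurd ha h

theorem prod_pow_mem_pow_sum {R ι : Type*} [CommRing R] (I : Ideal R) (s : Finset ι) (x : ι → R)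
    (c : ι → ℕ) (hx : ∀ i ∈ s, x i ∈ I) : ∏ i ∈ s, x i ^ c i ∈ I ^ ∑ i ∈ s, c i := by
  rw [← Finset.prod_pow_eq_pow_sum]
  exact Ideal.prod_mem_prod fun i hi => Ideal.pow_mem_pow (hx i hi) _

theorem isIntegralOverIdeal_of_pow_mem {R : Type*} [CommRing R] {I : Ideal R} {f : R} {L : ℕ}
    (hL : L ≠ 0) (h : f ^ L ∈ I ^ L) : IsIntegralOverIdeal I f := by
  rcases subsingleton_or_nontrivial R with hR | hR
  · exact ⟨0, Subsingleton.elim _ _, Subsingleton.elim _ _, fun i => by simp⟩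
  refine ⟨Polynomial.X ^ L - Polynomial.C (f ^ L), Polynomial.monic_X_pow_sub_C _ hL, by simp,
    fun i => ?_⟩
  rw [Polynomial.natDegree_X_pow_sub_C, Polynomial.coeff_sub, Polynomial.coeff_X_pow,
    Polynomial.coeff_C]
  refine sub_mem ?_ ?_
  · split_ifs with hi
    · simp [hi]
    · simp
  · split_ifs with hi
    · simpa [hi] using h
    · simp

theorem mem_idealIntegralClosure_monomialIdeal_pow_iff {G : Finset (Fin n →₀ ℕ)}
    (hG0 : ∀ g ∈ G, g ≠ 0)
    (hG : ∀ g ∈ G, ∀ h ∈ G, g ≠ h → Disjoint g.support h.support) {w : Fin n → ℕ} {L : ℕ}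
    (hL : L ≠ 0) (hw : ∀ g ∈ G, ∀ j ∈ g.support, w j * g j = L) (k : ℕ)
    (f : MvPolynomial (Fin n) K) :
    f ∈ idealIntegralClosure (monomialIdeal K G ^ k) ↔
      ∀ a ∈ f.support, k * L ≤ ∑ g ∈ G, blockOrder w g.support a := by
  classical
  have hgmem : ∀ g ∈ G, monomial g (1 : K) ∈ monomialIdeal K G := fun g hg =>
    Ideal.subset_span ⟨g, hg, rfl⟩
  have hne : ∀ g ∈ G, g.support.Nonempty := fun g hg => Finsupp.support_nonempty_iff.2 (hG0 g hg)
  constructor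
  · intro hf a ha
    have hJ : ∀ g : G, ∃ j ∈ (g : Fin n →₀ ℕ).support,
        w j * a j = blockOrder w (g : Fin n →₀ ℕ).support a :=
      fun g => exists_blockOrder_eq w (hne g g.2) a
    choose J hJ hJeq using hJ
    -- The valuation depends on `a`: it sees only one minimizing variable `J g` per block. By
    -- disjointness it equals `L` on each generator, and on `a` it equals the sum of the block
    -- minima.
    let v : Fin n → ℕ := fun i => ∑ g : G, if J g = i then w i else 0
    have hv : ∀ e : Fin n →₀ ℕ, ∑ i, v i * e i = ∑ g : G, w (J g) * e (J g) := by
      intro e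
      simp only [v, Finset.sum_mul]
      rw [Finset.sum_comm]
      refine Finset.sum_congr rfl fun g _ => ?_
      simp
    have hvg : ∀ g : G, ∑ i, v i * (g : Fin n →₀ ℕ) i = L := by
      intro g
      rw [hv, Finset.sum_eq_single g]
      · exact hw g g.2 _ (hJ g)
      · intro h _ hne
        have hd := hG h h.2 g g.2 fun e => hne (Subtype.ext e)
        rw [Finsupp.notMem_support_iff.1 (Finset.disjoint_left.1 hd (hJ h)), mul_zero]
      · exact fun h => absurd (Finset.mem_univ _) h
    have hle : monomialIdeal K G ≤ (Ideal.span {Polynomial.X ^ L}).comap (weightHom K v) := by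
      refine Ideal.span_le.2 ?_
      rintro _ ⟨g, hg, rfl⟩
      change weightHom K v (monomial g 1) ∈ Ideal.span {Polynomial.X ^ L}
      rw [Ideal.mem_span_singleton, weightHom_monomial, hvg ⟨g, hg⟩]
      exact dvd_mul_left _ _
    have hf' : IsIntegralOverIdeal (monomialIdeal K G ^ k) f := hf
    have hdvd := hf'.dvd_of_le_span_pow (weightHom K v).toRingHom Polynomial.prime_X (k * L) ?_
    · have := le_weight_of_X_pow_dvd_weightHom v (k * L) hdvd ha
      rw [hv] at this
      refine this.trans_eq ?_
      rw [← Finset.sum_coe_sort G]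
      exact Finset.sum_congr rfl fun g _ => hJeq g
    · intro x hx
      have h1 := Ideal.le_comap_pow (weightHom K v) k (Ideal.pow_right_mono hle k hx)
      rw [Ideal.mem_comap, Ideal.span_singleton_pow, Ideal.mem_span_singleton] at h1
      rwa [mul_comm, pow_mul]
  · intro hf
    rw [← support_sum_monomial_coeff f]
    refine Ideal.sum_mem _ fun a ha => ?_
    rw [← mul_one (coeff a f), ← smul_eq_mul, ← smul_monomial, smul_eq_C_mul]
    refine Ideal.mul_mem_left _ _ ?_
    change IsIntegralOverIdeal _ _
    refine isIntegralOverIdeal_of_pow_mem hL ?_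
    -- The product of the generators to the powers `c g` divides `x ^ (L • a)`, because `c g * g j ≤
    -- w j * a j * g j = L * a j`. As the `c g` add up to at least `k * L`, the `L`-th power of `x ^
    -- a` lies in `(I ^ k) ^ L`.
    let c : (Fin n →₀ ℕ) → ℕ := fun g => blockOrder w g.support a
    have hprod : ∏ g ∈ G, monomial g (1 : K) ^ c g = monomial (∑ g ∈ G, c g • g) 1 := by
      simp only [monomial_pow, one_pow]
      rw [monomial_sum_one]
    have hle : ∑ g ∈ G, c g • g ≤ L • a := by
      intro j
      simp only [Finsupp.finsetSum_apply, Finsupp.smul_apply, smul_eq_mul]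
      by_cases hj : ∃ g ∈ G, j ∈ g.support
      · obtain ⟨g, hg, hj⟩ := hj
        rw [Finset.sum_eq_single_of_mem g hg]
        · calc c g * g j ≤ (w j * a j) * g j := Nat.mul_le_mul_right _ (blockOrder_le w hj a)
            _ = L * a j := by rw [← hw g hg j hj]; ring
        · intro h hh hne
          rw [Finsupp.notMem_support_iff.1 (Finset.disjoint_right.1 (hG h hh g hg hne) hj),
            mul_zero]
      · rw [Finset.sum_eq_zero]
        · exact Nat.zero_le _
        · intro g hg
          rw [Finsupp.notMem_support_iff.1 fun h => hj ⟨g, hg, h⟩, mul_zero]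
    have hmem := prod_pow_mem_pow_sum (monomialIdeal K G) G (fun g => monomial g (1 : K)) c hgmem
    rw [hprod] at hmem
    rw [monomial_pow, one_pow, ← pow_mul, ← add_tsub_cancel_of_le hle,
      show (1 : K) = 1 * 1 from (one_mul 1).symm, ← monomial_mul]
    exact Ideal.mul_mem_right _ _ (Ideal.pow_le_pow_right (hf a ha) hmem)

end IntegralClosure

/-! ### From partitions into cells to Stanley decompositions, and back -/

section CellsToModules

variable {K : Type*} [Field K] {n : ℕ}

open MvPolynomial

theorem mem_stanleyCell_iff {p : Fin n →₀ ℕ} {Z : Finset (Fin n)} {a : Fin n →₀ ℕ} :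
    a ∈ stanleyCell p Z ↔ ∃ e : Fin n →₀ ℕ, e.support ⊆ Z ∧ a = p + e := by
  constructor
  · intro h
    refine ⟨a - p, fun j hj => ?_, (add_tsub_cancel_of_le fun j => (h j).1).symm⟩
    by_contra hjZ
    rw [Finsupp.mem_support_iff, Finsupp.tsub_apply, (h j).2 hjZ, tsub_self] at hj
    exact hj rfl
  · rintro ⟨e, he, rfl⟩ j
    refine ⟨by simp, fun hj => ?_⟩
    have : e j = 0 := Finsupp.notMem_support_iff.1 fun h => hj (he h)
    simp [this]

section Module

variable {M : Type*} [AddCommGroup M] [Module K M] [Module (MvPolynomial (Fin n) K) M]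

theorem stanleySpace_eq_span_image {b : (Fin n →₀ ℕ) → M} {p : Fin n →₀ ℕ} {Z : Finset (Fin n)}
    (hmul : ∀ e : Fin n →₀ ℕ, e.support ⊆ Z → monomial e (1 : K) • b p = b (p + e)) :
    stanleySpace K (b p) Z = Submodule.span K (b '' stanleyCell p Z) := by
  unfold stanleySpace
  congr 1
  ext m
  simp only [Set.mem_ofPred_eq, Set.mem_image, mem_stanleyCell_iff]
  constructor
  · rintro ⟨e, he, rfl⟩
    exact ⟨p + e, ⟨e, he, rfl⟩, (hmul e he).symm⟩
  · rintro ⟨_, ⟨e, he, rfl⟩, rfl⟩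
    exact ⟨e, he, (hmul e he).symm⟩

theorem eq_zero_of_smul_eq_zero_of_linearIndepOn [IsScalarTower K (MvPolynomial (Fin n) K) M]
    {b : (Fin n →₀ ℕ) → M} {p : Fin n →₀ ℕ} {Z : Finset (Fin n)}
    (hmul : ∀ e : Fin n →₀ ℕ, e.support ⊆ Z → monomial e (1 : K) • b p = b (p + e))
    (hli : LinearIndepOn K b (stanleyCell p Z))
    {q : MvPolynomial (Fin n) K} (hq : q ∈ supported K (Z : Set (Fin n))) (h : q • b p = 0) :
    q = 0 := by
  classical
  have hsupp : ∀ e ∈ q.support, e.support ⊆ Z := fun e he j hj => by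
    rw [mem_supported] at hq
    exact hq ((mem_vars_iff_mem_support j).2 ⟨e, he, hj⟩)
  have hsum : ∑ e ∈ q.support, coeff e q • b (p + e) = 0 := by
    rw [← h]
    nth_rewrite 3 [← support_sum_monomial_coeff q]
    rw [Finset.sum_smul]
    refine Finset.sum_congr rfl fun e he => ?_
    rw [← hmul e (hsupp e he), ← smul_assoc, smul_monomial, smul_eq_mul, mul_one]
  rw [linearIndepOn_iff'] at hli
  have h0 := hli (q.support.map (addLeftEmbedding p)) (fun i => coeff (i - p) q) ?_ ?_
  · rw [← support_eq_empty, Finset.eq_empty_iff_forall_notMem]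
    intro e he
    have := h0 (p + e) (Finset.mem_map.2 ⟨e, he, rfl⟩)
    rw [add_tsub_cancel_left] at this
    exact mem_support_iff.1 he this
  · intro i hi
    obtain ⟨e, he, rfl⟩ := Finset.mem_map.1 (Finset.mem_coe.1 hi)
    exact mem_stanleyCell_iff.2 ⟨e, hsupp e he, rfl⟩
  · rw [Finset.sum_map]
    simpa using hsum

theorem LinearIndepOn.iSupIndep_span_image {ι κ : Type*} {b : ι → M} {A : Set ι}
    (hli : LinearIndepOn K b A) {C : κ → Set ι} (hC : ∀ i, C i ⊆ A)
    (hdisj : Pairwise fun i j => Disjoint (C i) (C j)) :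
    iSupIndep fun i => Submodule.span K (b '' C i) := by
  intro i
  have himg : ∀ s : Set ι, s ⊆ A → b '' s = (fun a : A => b a) '' ((↑) ⁻¹' s) := by
    intro s hs
    ext x
    constructor
    · rintro ⟨a, ha, rfl⟩
      exact ⟨⟨a, hs ha⟩, ha, rfl⟩
    · rintro ⟨a, ha, rfl⟩
      exact ⟨a, ha, rfl⟩
  have hd : Disjoint (C i) (⋃ (j) (_ : j ≠ i), C j) := by
    simp only [Set.disjoint_iUnion_right]
    exact fun j hj => hdisj hj.symm
  have h := LinearIndependent.disjoint_span_image hli (hd.preimage ((↑) : A → ι))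
  rw [← himg _ (hC i), ← himg _ (Set.iUnion₂_subset fun j _ => hC j)] at h
  simpa only [Set.image_iUnion, Submodule.span_iUnion] using h

/-- A module with a basis of monomials indexed by a partitionable set of exponent vectors has
large Stanley depth. -/
theorem IsStanleyPartitionable.le_sdepth [IsScalarTower K (MvPolynomial (Fin n) K) M]
    {d : ℕ} {A : Set (Fin n →₀ ℕ)} (hA : IsStanleyPartitionable d A)
    (𝓜 : (Fin n → ℤ) → Submodule K M) (b : (Fin n →₀ ℕ) → M)
    (hhom : ∀ a ∈ A, ∃ c, b a ∈ 𝓜 c)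
    (hmul : ∀ a ∈ A, ∀ e : Fin n →₀ ℕ, a + e ∈ A → monomial e (1 : K) • b a = b (a + e))
    (hli : LinearIndepOn K b A) (hspan : Submodule.span K (b '' A) = ⊤) :
    (d : ℕ∞) ≤ sdepth 𝓜 := by
  obtain ⟨r, p, Z, hd, hdisj, hu⟩ := hA.exists_cells
  have hsub : ∀ i, stanleyCell (p i) (Z i) ⊆ A := fun i =>
    hu ▸ Set.subset_iUnion (fun i => stanleyCell (p i) (Z i)) i
  have hpA : ∀ i, p i ∈ A := fun i => hsub i (mem_stanleyCell_iff.2 ⟨0, by simp⟩)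
  have hmul' : ∀ i, ∀ e : Fin n →₀ ℕ, e.support ⊆ Z i →
      monomial e (1 : K) • b (p i) = b (p i + e) := fun i e he =>
    hmul _ (hpA i) e (hsub i (mem_stanleyCell_iff.2 ⟨e, he, rfl⟩))
  have hspace : (fun i => stanleySpace K (b (p i)) (Z i)) =
      fun i => Submodule.span K (b '' stanleyCell (p i) (Z i)) :=
    funext fun i => stanleySpace_eq_span_image (hmul' i)
  let D : StanleyDecomposition 𝓜 :=
    { r := r
      u := fun i => b (p i)
      Z := Z
      homogeneous := fun i => hhom _ (hpA i)
      free := fun i q hq h =>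
        eq_zero_of_smul_eq_zero_of_linearIndepOn (hmul' i) (hli.mono (hsub i)) hq h
      directSum := by
        rw [DirectSum.isInternal_submodule_iff_iSupIndep_and_iSup_eq_top, hspace]
        refine ⟨hli.iSupIndep_span_image hsub hdisj, ?_⟩
        rw [← Submodule.span_iUnion, ← Set.image_iUnion, hu, hspan] }
  exact le_iSup_of_le D (le_iInf fun i => by exact_mod_cast hd i)

end Module

/-! ### Monomial ideals and their quotients -/

section Ideals

variable {J : Ideal (MvPolynomial (Fin n) K)} {A : Set (Fin n →₀ ℕ)}

theorem monomial_mem_multigradedPiece (a : Fin n →₀ ℕ) (c : K) :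
    monomial a c ∈ multigradedPiece K (fun j => (a j : ℤ)) := by
  refine (mem_weightedHomogeneousSubmodule _ _ _ _).2 (isWeightedHomogeneous_monomial _ _ _ ?_)
  ext j
  simp [Finsupp.weight_apply, Finsupp.sum_fintype, Finset.sum_apply, Pi.single_apply]

/-- The degree of a monomial determines its exponent vector, so at most one monomial occurs. -/
theorem exists_eq_monomial_of_mem_multigradedPiece {d : Fin n → ℤ} {f : MvPolynomial (Fin n) K}
    (hf : f ∈ multigradedPiece K d) : ∃ a c, f = monomial a c := by
  by_cases h0 : f = 0
  · exact ⟨0, 0, by simp [h0]⟩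
  obtain ⟨a, ha⟩ := ne_zero_iff.1 h0
  have hw : ∀ e, coeff e f ≠ 0 → ∀ j, (e j : ℤ) = d j := by
    intro e he j
    rw [← (mem_weightedHomogeneousSubmodule _ _ _ _).1 hf he]
    simp [Finsupp.weight_apply, Finsupp.sum_fintype, Finset.sum_apply, Pi.single_apply]
  refine ⟨a, coeff a f, MvPolynomial.ext _ _ fun e => ?_⟩
  rw [coeff_monomial]
  split_ifs with hae
  · rw [hae]
  · by_contra hne
    refine hae (Finsupp.ext fun j => ?_)
    have := (hw a ha j).trans (hw e hne j).symm
    exact_mod_cast this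

theorem monomial_mem_iff_of_mem_iff (hJ : ∀ f, f ∈ J ↔ ∀ a ∈ f.support, a ∈ A)
    {a : Fin n →₀ ℕ} {c : K} (hc : c ≠ 0) : monomial a c ∈ J ↔ a ∈ A := by
  classical
  rw [hJ, support_monomial, if_neg hc]
  simp

theorem IsStanleyPartitionable.le_sdepthIdeal (hJ : ∀ f, f ∈ J ↔ ∀ a ∈ f.support, a ∈ A)
    {d : ℕ} (hA : IsStanleyPartitionable d A) : (d : ℕ∞) ≤ sdepthIdeal J := by
  classical
  have hmem : ∀ a ∈ A, monomial a (1 : K) ∈ J := fun a ha =>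
    (monomial_mem_iff_of_mem_iff hJ one_ne_zero).2 ha
  -- The value `0` off `A` is never used; it only makes `b` total.
  let b : (Fin n →₀ ℕ) → J := fun a =>
    if h : monomial a (1 : K) ∈ J then ⟨monomial a 1, h⟩ else 0
  have hb : ∀ a ∈ A, (b a : MvPolynomial (Fin n) K) = monomial a 1 := fun a ha => by
    simp [b, hmem a ha]
  refine hA.le_sdepth (idealPiece J) b ?_ ?_ ?_ ?_
  · intro a ha
    refine ⟨fun j => (a j : ℤ), ?_⟩
    change (b a : MvPolynomial (Fin n) K) ∈ multigradedPiece K (fun j => (a j : ℤ))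
    rw [hb a ha]
    exact monomial_mem_multigradedPiece a 1
  · intro a ha e hae
    refine Subtype.ext ?_
    rw [Submodule.coe_smul, hb a ha, hb _ hae, smul_eq_mul, monomial_mul, one_mul, add_comm]
  · rw [linearIndepOn_iff']
    intro t g ht h i hi
    have h1 := congrArg (fun x : J => coeff i (x : MvPolynomial (Fin n) K)) h
    simp only [Submodule.coe_sum, coeff_sum, Submodule.coe_zero, coeff_zero] at h1
    rw [Finset.sum_eq_single i] at h1
    · change coeff i (g i • (b i : MvPolynomial (Fin n) K)) = 0 at h1
      simpa [hb i (ht hi)] using h1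
    · intro j hj hji
      change coeff i (g j • (b j : MvPolynomial (Fin n) K)) = 0
      rw [hb j (ht hj), coeff_smul, coeff_monomial, if_neg hji, smul_zero]
    · exact fun h => absurd hi h
  · rw [eq_top_iff]
    rintro ⟨f, hf⟩ -
    have hsum : (⟨f, hf⟩ : J) = ∑ a ∈ f.support, coeff a f • b a := by
      refine Subtype.ext ?_
      rw [Submodule.coe_sum]
      refine (support_sum_monomial_coeff f).symm.trans (Finset.sum_congr rfl fun a ha => ?_)
      change _ = coeff a f • (b a : MvPolynomial (Fin n) K)
      rw [hb a ((hJ f).1 hf a ha), smul_monomial, smul_eq_mul, mul_one]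
    rw [hsum]
    exact Submodule.sum_mem _ fun a ha =>
      Submodule.smul_mem _ _ (Submodule.subset_span ⟨a, (hJ f).1 hf a ha, rfl⟩)

theorem mk_monomial_eq_smul (J : Ideal (MvPolynomial (Fin n) K)) (a : Fin n →₀ ℕ) (c : K) :
    Ideal.Quotient.mk J (monomial a c) = c • Ideal.Quotient.mk J (monomial a (1 : K)) := by
  rw [show monomial a c = c • monomial a (1 : K) by rw [smul_monomial, smul_eq_mul, mul_one]]
  rfl

theorem linearIndepOn_mk_monomial (hJ : ∀ f, f ∈ J ↔ ∀ a ∈ f.support, a ∈ A) :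
    LinearIndepOn K (fun a => Ideal.Quotient.mk J (monomial a (1 : K))) Aᶜ := by
  classical
  rw [linearIndepOn_iff']
  intro t g ht h i hi
  have h1 : ∑ i ∈ t, monomial i (g i) ∈ J := by
    rw [← Ideal.Quotient.eq_zero_iff_mem, map_sum, ← h]
    exact Finset.sum_congr rfl fun a _ => mk_monomial_eq_smul J a (g a)
  by_contra hne
  refine ht hi ((hJ _).1 h1 i ?_)
  rw [mem_support_iff, coeff_sum, Finset.sum_eq_single i]
  · simpa using hne
  · intro j _ hji
    rw [coeff_monomial, if_neg hji]
  · exact fun h => absurd hi h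

theorem IsStanleyPartitionable.le_sdepthQuotient (hJ : ∀ f, f ∈ J ↔ ∀ a ∈ f.support, a ∈ A)
    {d : ℕ} (hA : IsStanleyPartitionable d Aᶜ) : (d : ℕ∞) ≤ sdepthQuotient J := by
  refine hA.le_sdepth (quotientPiece J) (fun a => Ideal.Quotient.mk J (monomial a (1 : K)))
    ?_ ?_ (linearIndepOn_mk_monomial hJ) ?_
  · exact fun a _ => ⟨_, monomial a 1, monomial_mem_multigradedPiece a 1, rfl⟩
  · intro a _ e _
    change Ideal.Quotient.mk J (monomial e 1 * monomial a 1) = _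
    rw [monomial_mul, one_mul, add_comm]
  · rw [eq_top_iff]
    rintro x -
    obtain ⟨f, rfl⟩ := Ideal.Quotient.mk_surjective x
    rw [← support_sum_monomial_coeff f, map_sum]
    refine Submodule.sum_mem _ fun a _ => ?_
    rw [mk_monomial_eq_smul]
    refine Submodule.smul_mem _ _ ?_
    by_cases ha : a ∈ A
    · rw [Ideal.Quotient.eq_zero_iff_mem.2 ((monomial_mem_iff_of_mem_iff hJ one_ne_zero).2 ha)]
      exact zero_mem _
    · exact Submodule.subset_span ⟨a, ha, rfl⟩

/-- Homogeneous generators are classes of monomial terms. Freeness keeps their cells away from `A`,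
and since the monomials off `A` are linearly independent, those in the cells can span only if the
cells cover the complement of `A`. -/
theorem StanleyDecomposition.exists_mem_stanleyCell
    (hJ : ∀ f, f ∈ J ↔ ∀ a ∈ f.support, a ∈ A) (D : StanleyDecomposition (quotientPiece J))
    {a : Fin n →₀ ℕ} (ha : a ∉ A) :
    ∃ j p, a ∈ stanleyCell p (D.Z j) ∧ stanleyCell p (D.Z j) ⊆ Aᶜ := by
  have hu : ∀ j, ∃ p c, D.u j = Ideal.Quotient.mk J (monomial p c) := by
    intro j
    obtain ⟨d, f, hf, hfu⟩ := D.homogeneous j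
    obtain ⟨p, c, rfl⟩ := exists_eq_monomial_of_mem_multigradedPiece hf
    exact ⟨p, c, hfu.symm⟩
  choose p c hu using hu
  have hsmul : ∀ j, ∀ e : Fin n →₀ ℕ, monomial e (1 : K) • D.u j =
      Ideal.Quotient.mk J (monomial (p j + e) (c j)) := by
    intro j e
    rw [hu]
    change Ideal.Quotient.mk J (monomial e 1 * monomial (p j) (c j)) = _
    rw [monomial_mul, one_mul, add_comm]
  have hcell : ∀ j, stanleyCell (p j) (D.Z j) ⊆ Aᶜ := by
    intro j x hx hxA
    obtain ⟨e, he, rfl⟩ := mem_stanleyCell_iff.1 hx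
    have h0 := D.free j (monomial e 1) ?_ ?_
    · exact one_ne_zero (monomial_eq_zero.1 h0)
    · rw [mem_supported, vars_monomial one_ne_zero]
      exact_mod_cast he
    · rw [hsmul, Ideal.Quotient.eq_zero_iff_mem, hJ]
      intro y hy
      rwa [Finset.mem_singleton.1 (support_monomial_subset hy)]
  let b : (Fin n →₀ ℕ) → MvPolynomial (Fin n) K ⧸ J :=
    fun a => Ideal.Quotient.mk J (monomial a (1 : K))
  have hle : ∀ j, stanleySpace K (D.u j) (D.Z j) ≤
      Submodule.span K (b '' ⋃ j, stanleyCell (p j) (D.Z j)) := by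
    intro j
    refine Submodule.span_le.2 ?_
    rintro _ ⟨e, he, rfl⟩
    rw [hsmul, mk_monomial_eq_smul]
    exact Submodule.smul_mem _ _ (Submodule.subset_span
      ⟨_, Set.mem_iUnion.2 ⟨j, mem_stanleyCell_iff.2 ⟨e, he, rfl⟩⟩, rfl⟩)
  have htop : b a ∈ Submodule.span K (b '' ⋃ j, stanleyCell (p j) (D.Z j)) := by
    refine iSup_le hle ?_
    rw [((DirectSum.isInternal_submodule_iff_iSupIndep_and_iSup_eq_top _).1 D.directSum).2]
    exact Submodule.mem_top
  have hsub : insert a (⋃ j, stanleyCell (p j) (D.Z j)) ⊆ Aᶜ :=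
    Set.insert_subset ha (Set.iUnion_subset hcell)
  have hli := (linearIndepOn_mk_monomial hJ).mono hsub
  have hmem := (hli.mono (Set.subset_insert _ _)).mem_span_iff.1 htop hli
  obtain ⟨j, hj⟩ := Set.mem_iUnion.1 hmem
  exact ⟨j, p j, hj, hcell j⟩

/-- If adding a multiple of any of the unit vectors of `T` to `a ∉ A` leads into `A`, then the
Stanley depth of the quotient is at most `n - |T|`. -/
theorem sdepthQuotient_le_of_notMem (hJ : ∀ f, f ∈ J ↔ ∀ a ∈ f.support, a ∈ A)
    {a : Fin n →₀ ℕ} (ha : a ∉ A) (T : Finset (Fin n))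
    (hT : ∀ j ∈ T, ∃ m : ℕ, a + Finsupp.single j m ∈ A) :
    sdepthQuotient J ≤ ((n - T.card : ℕ) : ℕ∞) := by
  refine iSup_le fun D => ?_
  obtain ⟨j, p, hj, hsub⟩ := D.exists_mem_stanleyCell hJ ha
  refine (iInf_le _ j).trans ?_
  -- A cell through `a` with direction `i` free contains every `a + Finsupp.single i m`, yet it must
  -- avoid `A`.
  have hdisj : D.Z j ⊆ Tᶜ := by
    intro i hi
    rw [Finset.mem_compl]
    intro hiT
    obtain ⟨m, hm⟩ := hT i hiT
    refine hsub ?_ hm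
    obtain ⟨e, he, rfl⟩ := mem_stanleyCell_iff.1 hj
    refine mem_stanleyCell_iff.2 ⟨e + Finsupp.single i m, ?_, add_assoc _ _ _⟩
    refine Finsupp.support_add.trans (Finset.union_subset he ?_)
    exact Finsupp.support_single_subset.trans (Finset.singleton_subset_iff.2 hi)
  have := Finset.card_le_card hdisj
  rw [Finset.card_compl, Fintype.card_fin] at this
  exact_mod_cast this

end Ideals

end CellsToModules

/-! ### Common weights for disjoint generators and the resulting partitions -/

section Weights

variable {n : ℕ}

theorem exists_weights_of_disjoint_support {G : Finset (Fin n →₀ ℕ)}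
    (hG : ∀ g ∈ G, ∀ h ∈ G, g ≠ h → Disjoint g.support h.support) :
    ∃ (w : Fin n → ℕ) (L : ℕ), (∀ j, 0 < w j) ∧ L ≠ 0 ∧
      ∀ g ∈ G, ∀ j ∈ g.support, w j * g j = L := by
  -- At `j` at most one generator contributes to the sum, so `v j` is its exponent; the `max` covers
  -- variables in no generator. The product of all `v j` is a common multiple.
  let v : Fin n → ℕ := fun j => max 1 (∑ g ∈ G, g j)
  have hv : ∀ j, 0 < v j := fun j => lt_max_of_lt_left one_pos
  have hL : 0 < ∏ j, v j := Finset.prod_pos fun j _ => hv j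
  have hdvd : ∀ j, v j ∣ ∏ j, v j := fun j => Finset.dvd_prod_of_mem v (Finset.mem_univ j)
  refine ⟨fun j => (∏ j, v j) / v j, ∏ j, v j,
    fun j => Nat.div_pos (Nat.le_of_dvd hL (hdvd j)) (hv j), hL.ne', fun g hg j hj => ?_⟩
  have hgj : v j = g j := by
    have : ∑ h ∈ G, h j = g j := Finset.sum_eq_single_of_mem g hg fun h hh hne =>
      Finsupp.notMem_support_iff.1 (Finset.disjoint_right.1 (hG h hh g hg hne) hj)
    simp only [v, this]
    exact max_eq_right (Nat.one_le_iff_ne_zero.2 (Finsupp.mem_support_iff.1 hj))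
  rw [← hgj]
  exact Nat.div_mul_cancel (hdvd j)

theorem stanleyCell_zero_univ : stanleyCell (0 : Fin n →₀ ℕ) Finset.univ = Set.univ :=
  Set.eq_univ_of_forall fun _ j => ⟨Nat.zero_le _, fun h => absurd (Finset.mem_univ j) h⟩

theorem isStanleyPartitionable_sum_blockOrder_support {G : Finset (Fin n →₀ ℕ)}
    (hG0 : ∀ g ∈ G, g ≠ 0)
    (hG : ∀ g ∈ G, ∀ h ∈ G, g ≠ h → Disjoint g.support h.support) {w : Fin n → ℕ}
    (hw : ∀ j, 0 < w j) {N : ℕ} (hN : 1 ≤ N) (hGn : G.card ≤ n) :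
    IsStanleyPartitionable (n - G.card + 1) {a | N ≤ ∑ g ∈ G, blockOrder w g.support a} ∧
    IsStanleyPartitionable (n - G.card) {a | N ≤ ∑ g ∈ G, blockOrder w g.support a}ᶜ := by
  have hpw : (G.toList.map Finsupp.support).Pairwise Disjoint := by
    rw [List.pairwise_map]
    exact G.nodup_toList.pairwise_of_forall_ne fun g hg h hh hne =>
      hG g (Finset.mem_toList.1 hg) h (Finset.mem_toList.1 hh) hne
  have hne : ∀ S ∈ G.toList.map Finsupp.support, S.Nonempty := by
    intro S hS
    obtain ⟨g, hg, rfl⟩ := List.mem_map.1 hS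
    exact Finsupp.support_nonempty_iff.2 (hG0 g (Finset.mem_toList.1 hg))
  have hsum : ∀ a, ((G.toList.map Finsupp.support).map fun S => blockOrder w S a).sum =
      ∑ g ∈ G, blockOrder w g.support a := fun a => by
    rw [List.map_map, ← Finset.sum_map_toList]
    rfl
  have h := fun d => isStanleyPartitionable_sum_blockOrder w hw d _ hpw hne Finset.univ
    (fun S _ => Finset.subset_univ S) 0 (fun _ _ _ _ => rfl) N hN
  simp only [hsum, stanleyCell_zero_univ, Set.mem_univ, true_and, List.length_map,
    Finset.length_toList, Finset.card_univ, Fintype.card_fin] at h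
  refine ⟨(h _).2 (by omega), ?_⟩
  have h1 := (h (n - G.card)).1 (by omega)
  convert h1 using 1
  ext a
  simp

end Weights

/-! ### Proof of the theorem -/

theorem mainTheorem1 {K : Type*} [Field K] {n : ℕ} (t : ℕ)
    (I : Ideal (MvPolynomial (Fin n) K))
    (hci : IsCompleteIntersection I) (hI : IsMinimallyGeneratedByMonomials I t)
    (k : ℕ) (hk : 1 ≤ k) :
    t ≤ n ∧
      ((n - t + 1 : ℕ) : ℕ∞) ≤ sdepthIdeal (idealIntegralClosure (I ^ k)) ∧
      sdepthQuotient (idealIntegralClosure (I ^ k)) = ((n - t : ℕ) : ℕ∞) := by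
  classical
  obtain ⟨G, rfl, hmin⟩ := hI
  obtain ⟨hG0, hG⟩ := hci.disjoint_support hmin
  obtain ⟨w, L, hw, hL, hwL⟩ := exists_weights_of_disjoint_support hG
  have hJ := mem_idealIntegralClosure_monomialIdeal_pow_iff (K := K) hG0 hG hL hwL k
  rw [hmin.prop] at hJ
  have hN : 1 ≤ k * L := Nat.mul_pos hk (Nat.pos_of_ne_zero hL)
  have hJ' : ∀ f, f ∈ idealIntegralClosure (I ^ k) ↔
      ∀ a ∈ f.support, a ∈ {a | k * L ≤ ∑ g ∈ G, blockOrder w g.support a} := hJ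
  -- a choice of one variable from each generator
  have hF : ∀ g : G, ∃ j, j ∈ (g : Fin n →₀ ℕ).support := fun g =>
    Finsupp.support_nonempty_iff.2 (hG0 g g.2)
  choose F hF using hF
  have hFinj : ∀ g h : G, F g ∈ (h : Fin n →₀ ℕ).support → g = h := fun g h hgh => by
    by_contra hne
    exact Finset.disjoint_left.1 (hG g g.2 h h.2 fun e => hne (Subtype.ext e)) (hF g) hgh
  have hcard : (Finset.univ.image F).card = G.card := by
    rw [Finset.card_image_of_injective _ fun g h e => hFinj g h (by rw [e]; exact hF h),
      Finset.card_univ, Fintype.card_coe]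
  have hGn : G.card ≤ n := by
    rw [← hcard]
    exact (Finset.card_le_univ _).trans_eq (Fintype.card_fin n)
  obtain ⟨h1, h2⟩ := isStanleyPartitionable_sum_blockOrder_support hG0 hG hw hN hGn
  refine ⟨hGn, h1.le_sdepthIdeal hJ', le_antisymm ?_ (h2.le_sdepthQuotient hJ')⟩
  rw [← hcard]
  -- Every block contains a chosen variable with exponent `0`, so all block minima vanish at `a`.
  -- Raising the chosen variable of `g` by `k * L` lifts the whole block to at least `k * L`, as the
  -- other variables of `g` are unchosen and already have that exponent.
  let a : Fin n →₀ ℕ :=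
    Finsupp.equivFunOnFinite.symm fun j => if j ∈ Finset.univ.image F then 0 else k * L
  refine sdepthQuotient_le_of_notMem hJ' (a := a) ?_ _ ?_
  · rw [Set.mem_ofPred_eq, Finset.sum_eq_zero]
    · omega
    · intro g hg
      have := blockOrder_le w (hF ⟨g, hg⟩) a
      have ha : a (F ⟨g, hg⟩) = 0 :=
        if_pos (Finset.mem_image_of_mem F (Finset.mem_univ _))
      rw [ha, mul_zero] at this
      exact Nat.le_zero.1 this
  · intro j hj
    obtain ⟨g, -, rfl⟩ := Finset.mem_image.1 hj
    refine ⟨k * L, ?_⟩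
    rw [Set.mem_ofPred_eq]
    refine le_trans ?_ (Finset.single_le_sum
      (f := fun h : Fin n →₀ ℕ => blockOrder w h.support (a + Finsupp.single (F g) (k * L)))
      (fun _ _ => Nat.zero_le _) g.2)
    refine (le_blockOrder_iff w ⟨F g, hF g⟩ _ _).2 fun i hi => ?_
    refine le_trans ?_ (Nat.le_mul_of_pos_left _ (hw i))
    by_cases hig : i = F g
    · subst hig
      simp
    · have hiF : i ∉ Finset.univ.image F := fun h => by
        obtain ⟨g', -, rfl⟩ := Finset.mem_image.1 h
        exact hig (congrArg F (hFinj g' g hi))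
      have ha : a i = k * L := by
        simp only [a, Finsupp.coe_equivFunOnFinite_symm]
        exact if_neg hiF
      rw [Finsupp.add_apply, ha]
      exact Nat.le_add_right _ _
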